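/- Let $R$ be a commutative noetherian ring and let $\mathfrak m$ be a maximal ideal of $R$. For an $R$-algebra $S$ with structure map $\varphi\colon R\to S$, write $S/R$ for the $R$-module $S/\varphi(R)$. An $R$-module $C$ is $\mathfrak m$-adically complete if the natural map $C\to\varprojlim_n C/\mathfrak m^nC$ is an isomorphism. Let $\varphi\colon R\to S$ be a faithfully flat homomorphism of commutative rings, and let $C$ be an $\mathfrak m$-adically complete $R$-module. (a) $\operatorname{Ext}^i_R(S/R,C)=0=\operatorname{Ext}^i_R(S,C)$ for all $i\ge 1$. (b) If $R$ is local and the natural map $R/\mathfrak m\to S/\mathfrak mS$ is an isomorphism, then $\operatorname{Hom}_R(S/R,C)=0$, the module $C$ has an $S$-module structure compatible with its $R$-module structure via $\varphi$, and, for every such $S$-module structure, the natural maps $C\to\operatorname{Hom}_R(S,C)$, $c\mapsto(s\mapsto sc)$, and $\operatorname{Hom}_R(S,C)\to C$, $f\mapsto f(1)$, are mutually inverse isomorphisms of $S$-modules, where $S$ acts on $\operatorname{Hom}_R(S,C)$ by $(sf)(t)=f(st)$. (c) If $R$ is local and $\widehat R=\varprojlim_n R/\mathfrak m^n$ is its $\mathfrak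 m$-adic completion, then $\operatorname{Ext}^i_R(\widehat R/R,\widehat R)=0=\operatorname{Ext}^{i+1}_R(\widehat R,\widehat R)$ for all $i\ge 0$, and the natural maps $\widehat R\to\operatorname{Hom}_R(\widehat R,\widehat R)$, $x\mapsto(y\mapsto yx)$, and $\operatorname{Hom}_R(\widehat R,\widehat R)\to\widehat R$, $f\mapsto f(1)$, are mutually inverse isomorphisms of $\widehat R$-modules. -/

import Mathlib

universe u

/-- For an `R`-algebra `S`, the `R`-module `S/R`: the cokernel of the structure map `R → S`. -/
abbrev AlgCokernel (R S : Type u) [CommRing R] [CommRing S] [Algebra R S] : Type u :=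
  S ⧸ LinearMap.range (Algebra.linearMap R S)

/-- `Ext^i_R(M, N) = 0`, where `Ext` is computed in the abelian category of `R`-modules. -/
def ExtVanishes (R : Type u) [CommRing R] (M N : Type u) [AddCommGroup M] [Module R M]
    [AddCommGroup N] [Module R N] (i : ℕ) : Prop :=
  Subsingleton (CategoryTheory.Abelian.Ext (ModuleCat.of R M) (ModuleCat.of R N) i)

section NaturalMaps

variable (R S C : Type u) [CommRing R] [CommRing S] [Algebra R S] [AddCommGroup C] [Module R C]

/-- The natural evaluation map `Hom_R(S, C) → C`, `f ↦ f 1`. -/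
def evalAtOne : (S →ₗ[R] C) →ₗ[R] C where
  toFun f := f 1
  map_add' _ _ := rfl
  map_smul' _ _ := rfl

variable [Module S C] [IsScalarTower R S C]

/-- The natural map `C → Hom_R(S, C)`, `c ↦ (s ↦ s • c)`, for an `S`-module structure on `C` that is
compatible with its `R`-module structure. -/
def smulHom : C →ₗ[R] (S →ₗ[R] C) where
  toFun c :=
    { toFun := fun s => s • c
      map_add' := fun s t => add_smul s t c
      map_smul' := fun r s => smul_assoc r s c }
  map_add' c d := by ext s; exact smul_add s c d
  map_smul' r c := by ext s; exact smul_algebra_smul_comm r s c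

/-- The natural maps `C → Hom_R(S, C) → C` are mutually inverse isomorphisms of `S`-modules.
Here `s ∈ S` acts on `f ∈ Hom_R(S, C)` through the source: `(s f)(t) = f (s t)`. -/
def NaturalMapsInverse : Prop :=
  (∀ (s : S) (c : C), smulHom R S C (s • c) = smulHom R S C c ∘ₗ LinearMap.mulLeft R s) ∧
  (∀ (s : S) (f : S →ₗ[R] C), evalAtOne R S C (f ∘ₗ LinearMap.mulLeft R s) =
    s • evalAtOne R S C f) ∧
  evalAtOne R S C ∘ₗ smulHom R S C = LinearMap.id ∧
  smulHom R S C ∘ₗ evalAtOne R S C = LinearMap.id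

end NaturalMaps

/-!
Everything rests on one extension property. Let `0 → K → P → F → 0` be exact with `F` flat and `P`
projective, and let `C` be `m`-adically complete. Then every map `f : K → C` extends to `P`
(`LinearMap.exists_extension_of_flat`). The extension is built by successive approximation: if `h`
agrees with `f` on `K` modulo `m ^ n C`, the error is a map `K → m ^ n C`. Modulo `m ^ (n + 1) C` it
factors through `K / m K`. Flatness of `F` makes `K / m K → P / m P` an injection of vector spaces
over `R / m`, so the error extends to `P` modulo `m ^ (n + 1) C`, and the extension lifts to a map
`P → m ^ n C` by projectivity. The approximations converge because `C` is complete.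

The extension property says that `Ext¹(F, C) = 0`. As `K` is flat again, dimension shifting kills all
higher `Ext` groups (`extVanishes_of_flat`). The quotient `S / R` of a faithfully flat algebra is flat
by descent: after base change to `S` it becomes a direct summand of `S ⊗ S`
(`AlgCokernel.flat`). This settles the vanishing of `Ext`.

If moreover `R / m → S / m S` is surjective, then `S / R = m (S / R)`, so a map from `S / R` to the
separated module `C` is zero. Hence an `R`-linear map `S → C` is determined by its value at `1`, and
by `Ext¹(S / R, C) = 0` every value is attained. This turns `C` into an `S`-module and makes the two
natural maps mutually inverse. The completion of a noetherian local ring is a special case.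
-/

open scoped TensorProduct

/-! ### Flatness of kernels and of `S / R` -/

/-- The kernel of a surjection between flat modules is flat. -/
theorem Module.Flat.of_exact_of_surjective {R K P F : Type u} [CommRing R]
    [AddCommGroup K] [Module R K] [AddCommGroup P] [Module R P] [AddCommGroup F] [Module R F]
    [Module.Flat R F] [Module.Flat R P]
    {i : K →ₗ[R] P} {g : P →ₗ[R] F} (hi : Function.Injective i) (hg : Function.Surjective g)
    (hig : Function.Exact i g) : Module.Flat R K := by
  rw [Module.Flat.iff_rTensor_preserves_injective_linearMap]
  intro A B _ _ _ _ φ hφ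
  have h1 : Function.Injective (i.lTensor B ∘ₗ φ.rTensor K) := by
    rw [LinearMap.lTensor_comp_rTensor, ← LinearMap.rTensor_comp_lTensor]
    exact (Module.Flat.rTensor_preserves_injective_linearMap φ hφ).comp
      (LinearMap.lTensor_injective_of_exact_of_flat g hg i hi hig A)
  exact Function.Injective.of_comp h1

/-- The cokernel `S / R` of a faithfully flat algebra is flat. -/
theorem AlgCokernel.flat (R S : Type u) [CommRing R] [CommRing S] [Algebra R S]
    [Module.FaithfullyFlat R S] :
    Module.Flat R (AlgCokernel R S) := by
  let N := LinearMap.range (Algebra.linearMap R S)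
  -- `t ↦ 1 ⊗ t - t ⊗ 1` vanishes on the image of `R`, and its `S`-linear extension `σ` is a section
  -- of the projection `S ⊗ S → S ⊗ (S / R)`.
  let d : S →ₗ[R] S ⊗[R] S := TensorProduct.mk R S S 1 - (TensorProduct.mk R S S).flip 1
  have hd : N ≤ LinearMap.ker d := by
    rintro _ ⟨r, rfl⟩
    simp [d, Algebra.algebraMap_eq_smul_one]
  let σ : S ⊗[R] (S ⧸ N) →ₗ[S] S ⊗[R] S := (N.liftQ d hd).liftBaseChange S
  have : Module.Flat S (S ⊗[R] (S ⧸ N)) := by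
    refine Module.Flat.of_retract σ (N.mkQ.baseChange S) ?_
    ext t
    have h1 : (Submodule.Quotient.mk (1 : S) : S ⧸ N) = 0 :=
      (Submodule.Quotient.mk_eq_zero _).2 ⟨1, by simp⟩
    simp [σ, d, h1]
  exact Module.Flat.of_flat_tensorProduct R _ S

/-! ### Extending maps into complete modules -/

/-- If `0 → K → P → F → 0` is exact with `F` flat and `P` projective, then every map `K → N` extends
to `P` modulo `m N`. -/
theorem LinearMap.exists_extension_mod_smul_top {R K P F N : Type*} [CommRing R] (m : Ideal R)
    [m.IsMaximal]
    [AddCommGroup K] [Module R K] [AddCommGroup P] [Module R P] [AddCommGroup F] [Module R F]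
    [AddCommGroup N] [Module R N] [Module.Flat R F] [Module.Projective R P]
    {i : K →ₗ[R] P} {g : P →ₗ[R] F} (hi : Function.Injective i) (hg : Function.Surjective g)
    (hig : Function.Exact i g) (f : K →ₗ[R] N) :
    ∃ e : P →ₗ[R] N, ∀ x, f x - e (i x) ∈ (m • ⊤ : Submodule R N) := by
  let k := R ⧸ m
  let _ : Field k := Ideal.Quotient.field m
  let V := N ⧸ (m • ⊤ : Submodule R N)
  -- Since `F` is flat, this injection of vector spaces over `R / m` splits.
  have hinj : Function.Injective (i.baseChange k) :=
    LinearMap.lTensor_injective_of_exact_of_flat g hg i hi hig k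
  obtain ⟨r, hr⟩ := (i.baseChange k).exists_leftInverse_of_injective (LinearMap.ker_eq_bot.2 hinj)
  let fV : (k ⊗[R] K) →ₗ[k] V := ((Submodule.mkQ (m • ⊤ : Submodule R N)) ∘ₗ f).liftBaseChange k
  let eV : P →ₗ[R] V := ((fV ∘ₗ r).restrictScalars R) ∘ₗ (TensorProduct.mk R k P 1)
  obtain ⟨e, he⟩ := Module.projective_lifting_property
    (Submodule.mkQ (m • ⊤ : Submodule R N)) eV (Submodule.mkQ_surjective _)
  refine ⟨e, fun x => ?_⟩
  have h1 : r (1 ⊗ₜ[R] i x) = 1 ⊗ₜ[R] x := by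
    simpa using LinearMap.congr_fun hr ((1 : k) ⊗ₜ[R] x)
  have h2 : Submodule.mkQ (m • ⊤ : Submodule R N) (e (i x)) =
      Submodule.mkQ (m • ⊤ : Submodule R N) (f x) := by
    rw [← LinearMap.comp_apply, he]
    simp [eV, h1, fV]
  rw [← Submodule.Quotient.eq]
  exact h2.symm

/-- If `0 → K → P → F → 0` is exact with `F` flat and `P` projective, then every map from `K` to an
`m`-adically complete module extends to `P`. -/
theorem LinearMap.exists_extension_of_flat {R K P F C : Type*} [CommRing R] (m : Ideal R)
    [m.IsMaximal]
    [AddCommGroup K] [Module R K] [AddCommGroup P] [Module R P] [AddCommGroup F] [Module R F]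
    [AddCommGroup C] [Module R C] [Module.Flat R F] [Module.Projective R P] [IsAdicComplete m C]
    {i : K →ₗ[R] P} {g : P →ₗ[R] F} (hi : Function.Injective i) (hg : Function.Surjective g)
    (hig : Function.Exact i g) (f : K →ₗ[R] C) :
    ∃ h : P →ₗ[R] C, h ∘ₗ i = f := by
  -- `T n` is the type of maps on `P` that extend `f` modulo `m ^ n C`.
  let T (n : ℕ) : Type _ := {h : P →ₗ[R] C // ∀ x, f x - h (i x) ∈ (m ^ n • ⊤ : Submodule R C)}
  have step (n : ℕ) (h : T n) :
      ∃ h' : T (n + 1), ∀ p, h'.1 p - h.1 p ∈ (m ^ n • ⊤ : Submodule R C) := by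
    obtain ⟨e, he⟩ := LinearMap.exists_extension_mod_smul_top m hi hg hig
      ((f - h.1 ∘ₗ i).codRestrict (m ^ n • ⊤ : Submodule R C) h.2)
    refine ⟨⟨h.1 + Submodule.subtype _ ∘ₗ e, fun x => ?_⟩, fun p => by simp⟩
    have := Submodule.mem_map_of_mem (f := Submodule.subtype _) (he x)
    rw [Submodule.map_smul'', Submodule.map_subtype_top, ← mul_smul, ← pow_succ'] at this
    simpa [sub_sub] using this
  choose next hnext using step
  let t : (n : ℕ) → T n := fun n => Nat.rec ⟨0, by simp⟩ next n
  have hsucc (n : ℕ) (p : P) : (t (n + 1)).1 p - (t n).1 p ∈ (m ^ n • ⊤ : Submodule R C) :=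
    hnext n (t n) p
  have hle {a b : ℕ} (hab : a ≤ b) (p : P) :
      (t b).1 p - (t a).1 p ∈ (m ^ a • ⊤ : Submodule R C) := by
    induction b, hab using Nat.le_induction with
    | base => simp
    | succ b hb ih =>
      rw [← sub_add_sub_cancel _ ((t b).1 p)]
      exact add_mem (Submodule.smul_mono_left (Ideal.pow_le_pow_right hb) (hsucc b p)) ih
  let L := IsAdicComplete.lift m (fun n => Submodule.mkQ (m ^ n • ⊤ : Submodule R C) ∘ₗ (t n).1)
    (fun {a b} hab => by
      ext p
      exact (Submodule.Quotient.eq _).2 (hle hab p))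
  refine ⟨L, ?_⟩
  apply DFunLike.coe_injective
  apply IsHausdorff.funext m
  intro n x
  have h1 : Submodule.Quotient.mk (p := (m ^ n • ⊤ : Submodule R C)) (L (i x)) =
      Submodule.Quotient.mk ((t n).1 (i x)) := IsAdicComplete.mk_lift m _ n (i x)
  exact h1.trans ((Submodule.Quotient.eq _).2 ((t n).2 x)).symm

/-! ### Vanishing of `Ext` -/

open CategoryTheory CategoryTheory.Abelian in
/-- `Ext¹(F, C)` is the obstruction to extending maps into `C` from the kernel of a surjection from a
projective module to `F`; the higher groups vanish by dimension shifting, as the kernel is flat. -/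
theorem extVanishes_of_flat {R : Type u} [CommRing R] (m : Ideal R) [m.IsMaximal] (F C : Type u)
    [AddCommGroup F] [Module R F] [Module.Flat R F] [AddCommGroup C] [Module R C]
    [IsAdicComplete m C] (n : ℕ) : ExtVanishes R F C (n + 1) := by
  induction n generalizing F with
  | zero =>
    let g : (F →₀ R) →ₗ[R] F := Finsupp.linearCombination R id
    have hg : Function.Surjective g := Finsupp.linearCombination_id_surjective R F
    have hS := g.shortExact_shortComplexKer hg
    have : Projective (ModuleCat.of R (F →₀ R)) :=
      (IsProjective.iff_projective (F →₀ R)).1 inferInstance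
    refine subsingleton_of_forall_eq 0 fun x => ?_
    obtain ⟨y, rfl⟩ := Ext.contravariant_sequence_exact₃ hS _ x
      (Ext.eq_zero_of_projective (P := ModuleCat.of R (F →₀ R)) _) (n₀ := 0) rfl
    obtain ⟨f, rfl⟩ := (Ext.mk₀_bijective _ _).2 y
    obtain ⟨h, hh⟩ := LinearMap.exists_extension_of_flat m (LinearMap.ker g).injective_subtype hg
      (LinearMap.exact_subtype_ker_map g) f.hom
    have hf : f = g.shortComplexKer.f ≫ ModuleCat.ofHom h := by
      ext x
      exact (LinearMap.congr_fun hh x).symm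
    rw [hf, ← Ext.mk₀_comp_mk₀, hS.extClass_comp_assoc]
  | succ n ih =>
    let g : (F →₀ R) →ₗ[R] F := Finsupp.linearCombination R id
    have hg : Function.Surjective g := Finsupp.linearCombination_id_surjective R F
    have hS := g.shortExact_shortComplexKer hg
    have : Projective (ModuleCat.of R (F →₀ R)) :=
      (IsProjective.iff_projective (F →₀ R)).1 inferInstance
    have : Module.Flat R (LinearMap.ker g) :=
      .of_exact_of_surjective (K := LinearMap.ker g) (LinearMap.ker g).injective_subtype hg
        (LinearMap.exact_subtype_ker_map g)
    refine subsingleton_of_forall_eq 0 fun x => ?_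
    obtain ⟨y, rfl⟩ := Ext.contravariant_sequence_exact₃ hS _ x
      (Ext.eq_zero_of_projective (P := ModuleCat.of R (F →₀ R)) _) (n₀ := n + 1) (add_comm _ _)
    have := ih (LinearMap.ker g)
    rw [ExtVanishes] at this
    rw [this.elim y 0, Ext.comp_zero]

open CategoryTheory CategoryTheory.Abelian in
/-- If `R → S` is injective and `Ext¹(S / R, C) = 0`, then every element of `C` is the value at `1`
of an `R`-linear map `S → C`. -/
theorem evalAtOne_surjective {R S C : Type u} [CommRing R] [CommRing S] [Algebra R S]
    [FaithfulSMul R S] [AddCommGroup C] [Module R C] (h : ExtVanishes R (AlgCokernel R S) C 1) :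
    Function.Surjective (evalAtOne R S C) := by
  intro c
  let N := LinearMap.range (Algebra.linearMap R S)
  have hex : Function.Exact (Algebra.linearMap R S) N.mkQ :=
    LinearMap.exact_iff.2 N.ker_mkQ
  let T := ModuleCat.shortComplexOfCompEqZero (Algebra.linearMap R S) N.mkQ
    hex.linearMap_comp_eq_zero
  have hT : T.ShortExact := ModuleCat.shortComplex_shortExact T hex
    (FaithfulSMul.algebraMap_injective R S) N.mkQ_surjective
  let f : ModuleCat.of R R ⟶ ModuleCat.of R C := ModuleCat.ofHom (LinearMap.toSpanSingleton R C c)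
  obtain ⟨y, hy⟩ := Ext.contravariant_sequence_exact₁ hT _ (Ext.mk₀ f) (n₁ := 1) rfl (h.elim _ _)
  obtain ⟨e, rfl⟩ := (Ext.mk₀_bijective _ _).2 y
  rw [Ext.mk₀_comp_mk₀] at hy
  have he := LinearMap.congr_fun (congrArg ModuleCat.Hom.hom ((Ext.mk₀_bijective _ _).1 hy)) (1 : R)
  refine ⟨e.hom, ?_⟩
  simpa [T, f, evalAtOne] using he

/-! ### Maps from `S` to complete modules -/

/-- If `S = R + m S`, then `S / R = m (S / R)` maps trivially to every `m`-adically separated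
module. -/
theorem AlgCokernel.subsingleton_hom {R S C : Type u} [CommRing R] [CommRing S] [Algebra R S]
    [AddCommGroup C] [Module R C] (m : Ideal R) [IsHausdorff m C]
    (h : ∀ s : S, ∃ r : R, s - algebraMap R S r ∈ m.map (algebraMap R S)) :
    Subsingleton (AlgCokernel R S →ₗ[R] C) := by
  have htop : m • (⊤ : Submodule R (AlgCokernel R S)) = ⊤ := by
    refine eq_top_iff.2 fun q _ => ?_
    obtain ⟨s, rfl⟩ := Submodule.mkQ_surjective _ q
    obtain ⟨r, hr⟩ := h s
    have h1 : s - algebraMap R S r ∈ m • (⊤ : Submodule R S) := by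
      rwa [Ideal.smul_top_eq_map]
    have h2 := Submodule.mem_map_of_mem (f := (LinearMap.range (Algebra.linearMap R S)).mkQ) h1
    rw [Submodule.map_smul'', map_sub] at h2
    have h3 : (LinearMap.range (Algebra.linearMap R S)).mkQ (algebraMap R S r) = 0 :=
      (Submodule.Quotient.mk_eq_zero _).2 ⟨r, rfl⟩
    rw [h3, sub_zero] at h2
    exact Submodule.smul_mono le_rfl le_top h2
  have hpow (n : ℕ) : m ^ n • (⊤ : Submodule R (AlgCokernel R S)) = ⊤ := by
    induction n with
    | zero => simp
    | succ n ih => rw [pow_succ, mul_smul, htop, ih]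
  refine subsingleton_of_forall_eq 0 fun φ => LinearMap.ext fun q => ?_
  refine IsHausdorff.haus ‹_› (φ q) fun n => ?_
  rw [SModEq.zero]
  have hq : q ∈ m ^ n • (⊤ : Submodule R (AlgCokernel R S)) := by rw [hpow]; trivial
  have h1 := Submodule.mem_map_of_mem (f := φ) hq
  rw [Submodule.map_smul''] at h1
  exact Submodule.smul_mono le_rfl le_top h1

theorem evalAtOne_injective {R S C : Type u} [CommRing R] [CommRing S] [Algebra R S]
    [AddCommGroup C] [Module R C] [Subsingleton (AlgCokernel R S →ₗ[R] C)] :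
    Function.Injective (evalAtOne R S C) := by
  refine (injective_iff_map_eq_zero _).2 fun f hf => ?_
  have hle : LinearMap.range (Algebra.linearMap R S) ≤ LinearMap.ker f := by
    rintro _ ⟨r, rfl⟩
    have hf' : f 1 = 0 := hf
    simp [Algebra.algebraMap_eq_smul_one, hf']
  rw [← Submodule.liftQ_mkQ _ f hle, Subsingleton.elim (Submodule.liftQ _ f hle) 0,
    LinearMap.zero_comp]

/-- If evaluation at `1` is bijective on `Hom_R(S, C)`, then `C` is an `S`-module: `s • c` is the
value at `s` of the unique map sending `1` to `c`. -/
theorem exists_module_of_evalAtOne_bijective {R S C : Type u} [CommRing R] [CommRing S]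
    [Algebra R S] [AddCommGroup C] [Module R C] (h : Function.Bijective (evalAtOne R S C)) :
    ∃ _ : Module S C, IsScalarTower R S C := by
  choose E hE using h.2
  have hE' (c : C) : E c 1 = c := hE c
  have huniq {f g : S →ₗ[R] C} (hfg : f 1 = g 1) (s : S) : f s = g s :=
    LinearMap.congr_fun (h.1 hfg) s
  let _ : Module S C :=
    { smul := fun s c => E c s
      one_smul := hE'
      mul_smul := fun s t c => by
        change E c (s * t) = E (E c t) s
        exact huniq (f := E c ∘ₗ LinearMap.mulRight R t) (by simp [hE']) s
      smul_zero := fun s => huniq (f := E 0) (g := 0) (hE' 0) s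
      smul_add := fun s c d => huniq (f := E (c + d)) (g := E c + E d) (by simp [hE']) s
      add_smul := fun s t c => map_add (E c) s t
      zero_smul := fun c => map_zero (E c) }
  exact ⟨inferInstance, ⟨fun r s c => map_smul (E c) r s⟩⟩

/-- The maps `f` and `s ↦ s • f 1` agree at `1`, so they are equal if evaluation at `1` is
injective. -/
theorem naturalMapsInverse_of_evalAtOne_injective {R S C : Type u} [CommRing R] [CommRing S]
    [Algebra R S] [AddCommGroup C] [Module R C] [Module S C] [IsScalarTower R S C]
    (h : Function.Injective (evalAtOne R S C)) : NaturalMapsInverse R S C := by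
  have key (f : S →ₗ[R] C) : smulHom R S C (evalAtOne R S C f) = f :=
    h (one_smul S (f 1))
  refine ⟨fun s c => ?_, fun s f => ?_, ?_, LinearMap.ext key⟩
  · ext t
    change t • s • c = (s * t) • c
    rw [smul_smul, mul_comm]
  · change f (s * 1) = s • f 1
    rw [mul_one]
    exact (LinearMap.congr_fun (key f) s).symm
  · ext c
    exact one_smul S c

/-! ### The completion of a local ring -/

open IsLocalRing in
/-- `R̂ = R + m R̂` for a noetherian local ring `R`, as `R` and `R̂` have the same residue field. -/
theorem AdicCompletion.exists_sub_algebraMap_mem {R : Type u} [CommRing R] [IsNoetherianRing R]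
    [IsLocalRing R] (s : AdicCompletion (maximalIdeal R) R) :
    ∃ r : R, s - algebraMap R _ r ∈
      (maximalIdeal R).map (algebraMap R (AdicCompletion (maximalIdeal R) R)) := by
  obtain ⟨x, hx⟩ := (AdicCompletion.residueField_map_bijective R).2 (residue _ s)
  obtain ⟨r, rfl⟩ := residue_surjective x
  rw [ResidueField.map_residue] at hx
  exact ⟨r, AdicCompletion.maximalIdeal_eq_map (R := R) ▸
    (Ideal.Quotient.mk_eq_mk_iff_sub_mem _ _).1 hx.symm⟩

theorem lemma4p1 (R : Type u) [CommRing R] [IsNoetherianRing R] (m : Ideal R) [m.IsMaximal] :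
    (∀ (S C : Type u) [CommRing S] [Algebra R S] [Module.FaithfullyFlat R S]
        [AddCommGroup C] [Module R C] [IsAdicComplete m C],
      (∀ i : ℕ, 1 ≤ i → ExtVanishes R (AlgCokernel R S) C i ∧ ExtVanishes R S C i) ∧
      (IsLocalRing R →
        Function.Bijective (Ideal.quotientMap (m.map (algebraMap R S)) (algebraMap R S)
          (Ideal.le_comap_map (I := m))) →
        Subsingleton (AlgCokernel R S →ₗ[R] C) ∧
        (∃ _ : Module S C, IsScalarTower R S C) ∧
        (∀ [Module S C] [IsScalarTower R S C], NaturalMapsInverse R S C))) ∧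
    (IsLocalRing R →
      (∀ i : ℕ,
        ExtVanishes R (AlgCokernel R (AdicCompletion m R)) (AdicCompletion m R) i ∧
        ExtVanishes R (AdicCompletion m R) (AdicCompletion m R) (i + 1)) ∧
      NaturalMapsInverse R (AdicCompletion m R) (AdicCompletion m R)) := by
  refine ⟨?_, ?_⟩
  · intro S C _ _ _ _ _ _
    have := AlgCokernel.flat R S
    have hExt (i : ℕ) (hi : 1 ≤ i) : ExtVanishes R (AlgCokernel R S) C i ∧ ExtVanishes R S C i := by
      obtain ⟨n, rfl⟩ := Nat.exists_eq_add_of_le' hi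
      exact ⟨extVanishes_of_flat m _ C n, extVanishes_of_flat m S C n⟩
    refine ⟨hExt, fun _ hbij => ?_⟩
    have hHom : Subsingleton (AlgCokernel R S →ₗ[R] C) := by
      refine AlgCokernel.subsingleton_hom m fun s => ?_
      obtain ⟨x, hx⟩ := hbij.2 (Ideal.Quotient.mk _ s)
      obtain ⟨r, rfl⟩ := Ideal.Quotient.mk_surjective x
      rw [Ideal.quotientMap_mk] at hx
      exact ⟨r, (Ideal.Quotient.mk_eq_mk_iff_sub_mem _ _).1 hx.symm⟩
    exact ⟨hHom, exists_module_of_evalAtOne_bijective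
      ⟨evalAtOne_injective, evalAtOne_surjective (hExt 1 le_rfl).1⟩,
      naturalMapsInverse_of_evalAtOne_injective evalAtOne_injective⟩
  · intro _
    obtain rfl := IsLocalRing.eq_maximalIdeal (I := m) inferInstance
    let m := IsLocalRing.maximalIdeal R
    have : IsAdicComplete m (AdicCompletion m R) :=
      AdicCompletion.isAdicComplete m.fg_of_isNoetherianRing
    have : Module.FaithfullyFlat R (AdicCompletion m R) := .of_flat_of_isLocalHom
    have := AlgCokernel.flat R (AdicCompletion m R)
    have hHom : Subsingleton (AlgCokernel R (AdicCompletion m R) →ₗ[R] AdicCompletion m R) :=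
      AlgCokernel.subsingleton_hom m AdicCompletion.exists_sub_algebraMap_mem
    refine ⟨fun i => ⟨?_, extVanishes_of_flat m _ _ i⟩,
      naturalMapsInverse_of_evalAtOne_injective evalAtOne_injective⟩
    cases i with
    | zero =>
      -- `Ext⁰` is `Hom`.
      have : Subsingleton (ModuleCat.of R (AlgCokernel R (AdicCompletion m R)) ⟶
          ModuleCat.of R (AdicCompletion m R)) := ModuleCat.homEquiv.subsingleton
      exact CategoryTheory.Abelian.Ext.homEquiv₀.subsingleton
    | succ n => exact extVanishes_of_flat m _ _ n
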